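/- Let $\Gamma$ be a group with neutral element $1$. For $g,h\in\Gamma$ put $[g,h]_0=h$ and $[g,h]_{m+1}=g\,[g,h]_m^{-1}\,g^{-1}\,[g,h]_m$ for $m\ge 0$, so that $[g,h]_1=gh^{-1}g^{-1}h$. Let $n\ge 0$ be an integer and suppose that $\Gamma$ is nilpotent of class $\le n$ in the sense that $[g,h]_n=1$ for all $g,h\in\Gamma$ with $g\ne h$ and $g\neq h^{-1}$ (every nilpotent group of nilpotency class at most $n$ in the usual sense has this property). Let $S\subseteq\Gamma\setminus\{1\}$ be a generating set of $\Gamma$ that is closed under taking inverses, and let $G=\mathrm{Cay}(\Gamma,S)$ be the simple graph with vertex set $\Gamma$ and edge set $\{\{g,gs\}: g\in\Gamma,\ s\in S\}$. For a vertex $v$ of $G$ and an integer $r$, let $B_r(v)$ be the subgraph of $G$ formed by the vertices and edges that lie on closed walks of length at most $r$ through $v$. The vertex $v$ is an *$r$-local cutvertex* of $G$ if $B_r(v)-v$ is disconnected. For two distinct vertices $x,y$, the *connectivity graph* $C_r(x,y)$ has as vertices all vertices outside $\{x,y\}$ with a neighbour in $\{x,y\}$, and two distinct such vertices are adjacent if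 they lie in the same component of $B_r(x)-x-y$ or in the same component of $B_r(y)-x-y$. The set $\{x,y\}$ is an *$r$-local $2$-separator* of $G$ if $C_r(x,y)$ is disconnected and the distance between $x$ and $y$ in $G$ is at most $r/2$. **Theorem.** Let $r\ge\max\{2^{n+2},10\}$ be an integer, and let $h\in S$ be such that $\{1,h\}$ is an $r$-local $2$-separator of $G$. Suppose that $G$ has no $r$-local cutvertex. If $h$ is an involution, then the subgroup $\langle h\rangle$ of $\Gamma$ generated by $h$ is normal in $\Gamma$. -/

import Mathlib

namespace SimpleGraph

variable {V : Type*} (G : SimpleGraph V)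

/-- The ball of diameter `r` around `v`: the subgraph formed by all vertices and edges that lie on
closed walks of length at most `r` passing through `v`. (Rotating such a closed walk, one may
let it start and end at `v`.) -/
def localBall (r : ℕ) (v : V) : G.Subgraph where
  verts := {u | ∃ W : G.Walk v v, W.length ≤ r ∧ u ∈ W.support}
  Adj a b := ∃ W : G.Walk v v, W.length ≤ r ∧ s(a, b) ∈ W.edges
  adj_sub := by
    rintro a b ⟨W, -, hW⟩
    exact W.adj_of_mem_edges hW
  edge_vert := by
    rintro a b ⟨W, hr, hW⟩
    exact ⟨W, hr, W.fst_mem_support_of_mem_edges hW⟩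
  symm := ⟨by
    rintro a b ⟨W, hr, hW⟩
    exact ⟨W, hr, by rwa [Sym2.eq_swap]⟩⟩

/-- `v` is an `r`-local cutvertex: the ball of diameter `r` around `v` becomes disconnected when
`v` is deleted. -/
def IsLocalCutvertex (r : ℕ) (v : V) : Prop :=
  ¬ ((G.localBall r v).deleteVerts {v}).coe.Preconnected

/-- `a` and `b` are vertices of the subgraph `H` lying in the same component of `H`. -/
def Subgraph.SameComponent {G : SimpleGraph V} (H : G.Subgraph) (a b : V) : Prop :=
  ∃ (ha : a ∈ H.verts) (hb : b ∈ H.verts), H.coe.Reachable ⟨a, ha⟩ ⟨b, hb⟩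

/-- The neighbourhood `N(X)` of a set `X` of vertices: the vertices outside `X` that have a
neighbour in `X`. -/
def setNeighborhood (X : Set V) : Set V :=
  {u | u ∉ X ∧ ∃ x ∈ X, G.Adj x u}

/-- The connectivity graph at `{x, y}` of locality `r`. Its vertex set is `N({x, y})`, and two
distinct vertices are adjacent if they lie in the same component of the ball around `x`, or of the
ball around `y`, after the deletion of both `x` and `y`. -/
def connectivityGraph (r : ℕ) (x y : V) : SimpleGraph (G.setNeighborhood {x, y}) where
  Adj a b := a ≠ b ∧
    (((G.localBall r x).deleteVerts {x, y}).SameComponent a b ∨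
      ((G.localBall r y).deleteVerts {x, y}).SameComponent a b)
  symm := ⟨by
    rintro a b ⟨hne, h | h⟩
    · obtain ⟨ha, hb, h⟩ := h
      exact ⟨hne.symm, Or.inl ⟨hb, ha, h.symm⟩⟩
    · obtain ⟨ha, hb, h⟩ := h
      exact ⟨hne.symm, Or.inr ⟨hb, ha, h.symm⟩⟩⟩
  loopless := ⟨fun _ h => h.1 rfl⟩

/-- `{x, y}` is an `r`-local 2-separator: `x` and `y` are distinct vertices at distance at most
`r / 2`, and the connectivity graph at `{x, y}` of locality `r` is disconnected. -/
def IsLocalTwoSeparator (r : ℕ) (x y : V) : Prop :=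
  x ≠ y ∧ 2 * G.edist x y ≤ r ∧ ¬ (G.connectivityGraph r x y).Preconnected

end SimpleGraph

/-- The iterated commutator `[g, h]ₙ`, where `[g, h]₁ = g h⁻¹ g⁻¹ h` and
`[g, h]ₙ₊₁ = [g, [g, h]ₙ]₁`; here `[g, h]₀ = h`. -/
def iteratedCommutator {Γ : Type*} [Group Γ] (g h : Γ) : ℕ → Γ
  | 0 => h
  | n + 1 => g * (iteratedCommutator g h n)⁻¹ * g⁻¹ * iteratedCommutator g h n

/-- Nilpotency of class at most `n` in the sense of iterated commutators: `[g, h]ₙ = 1` for all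
inequivalent `g` and `h`, that is, whenever `g ≠ h` and `g ≠ h⁻¹`. Groups of nilpotency class at
most `n` in the usual sense satisfy this, as shown in
`iteratedCommutatorNilpotent_of_nilpotencyClass_le`. -/
def IteratedCommutatorNilpotent (Γ : Type*) [Group Γ] (n : ℕ) : Prop :=
  ∀ g h : Γ, g ≠ h → g ≠ h⁻¹ → iteratedCommutator g h n = 1

theorem iteratedCommutator_mem_lowerCentralSeries {Γ : Type*} [Group Γ] (g h : Γ) (n : ℕ) :
    iteratedCommutator g h n ∈ Subgroup.lowerCentralSeries (⊤ : Subgroup Γ) n := by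
  induction n with
  | zero => exact Subgroup.mem_top h
  | succ n ih =>
    have key := inv_mem (Subgroup.commutator_mem_commutator (inv_mem ih) (Subgroup.mem_top g))
    rw [commutatorElement_inv, commutatorElement_def, inv_inv] at key
    exact key

/-- Every nilpotent group of nilpotency class at most `n` (in the usual sense, via central series)
satisfies the condition on iterated commutators. -/
theorem iteratedCommutatorNilpotent_of_nilpotencyClass_le {Γ : Type*} [Group Γ]
    [Group.IsNilpotent Γ] {n : ℕ} (hn : Group.nilpotencyClass Γ ≤ n) :
    IteratedCommutatorNilpotent Γ n := by
  intro g h _ _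
  have key := iteratedCommutator_mem_lowerCentralSeries g h n
  rw [Subgroup.lowerCentralSeries_eq_bot_iff_nilpotencyClass_le.mpr hn] at key
  exact Subgroup.mem_bot.mp key

/-! Left translation turns `{1, h}` into a local separator at every coset `c⟨h⟩`. If a short closed
walk passes from one side of `c⟨h⟩` to the other, it must meet that coset again: otherwise the rest
of the walk joins the two sides. By induction on the length of the return, `turnPath_not_mem` rules
out such returns once they are excluded on stretches without interior crossings. So a word that
crosses often enough cannot equal `1`, whereas nilpotency supplies short words that do.

Suppose a generator `g` does not commute with `h`. Words built from `[h, g]` and `[h, g⁻²]` show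
that `g`, `g⁻¹` and their translates by `h` lie on one side of `⟨h⟩`
(`locallyConnected_inv_mul_inv`, `locallyConnected_inv`). Disconnectedness gives a generator `s` on
another side, and then the iterated commutator of `g` and `s` is a word that crosses too often to be
trivial. Hence `h` commutes with all generators and is central. -/

namespace SimpleGraph

/-! ### Short walks and components of the connectivity graph. -/

variable {V : Type*} {G : SimpleGraph V}

theorem Subgraph.sameComponent_of_walk (H : G.Subgraph) {u v : V} (W : G.Walk u v)
    (hu : u ∈ H.verts) (hW : ∀ a b, s(a, b) ∈ W.edges → H.Adj a b) : H.SameComponent u v := by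
  induction W with
  | nil => exact ⟨hu, hu, Reachable.refl _⟩
  | @cons a b c hab W ih =>
    have h1 : H.Adj a b := hW a b (by simp)
    obtain ⟨hb, hc, hr⟩ := ih h1.snd_mem fun x y hxy => hW x y (by simp [hxy])
    have h2 : H.coe.Adj ⟨a, hu⟩ ⟨b, hb⟩ := h1
    exact ⟨hu, hc, h2.reachable.trans hr⟩

/-- A closed walk through `z` of length at most `r` contains every subwalk in the ball at `z`. -/
theorem sameComponent_localBall_deleteVerts {r : ℕ} {z u v w : V} {A : Set V}
    (hzw : z = w ∨ G.Adj z w) (hwu : G.Adj w u) (W : G.Walk u v) (hvz : G.Adj v z)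
    (hA : ∀ a ∈ W.support, a ∉ A) (hlen : W.length + 3 ≤ r) :
    ((G.localBall r z).deleteVerts A).SameComponent u v := by
  obtain ⟨C, hC, hCe, hCs⟩ : ∃ C : G.Walk z z, C.length ≤ r ∧ (∀ e ∈ W.edges, e ∈ C.edges) ∧
      ∀ a ∈ W.support, a ∈ C.support := by
    rcases hzw with rfl | hzw
    · refine ⟨.cons hwu (W.concat hvz), by simp; omega, ?_, ?_⟩
      · intro e he; simp [Walk.edges_concat, he]
      · intro a ha; simp [Walk.support_concat, ha]
    · refine ⟨.cons hzw (.cons hwu (W.concat hvz)), by simp; omega, ?_, ?_⟩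
      · intro e he; simp [Walk.edges_concat, he]
      · intro a ha; simp [Walk.support_concat, ha]
  apply Subgraph.sameComponent_of_walk _ W
  · exact ⟨⟨C, hC, hCs _ W.start_mem_support⟩, hA _ W.start_mem_support⟩
  · intro a b hab
    rw [Subgraph.deleteVerts_adj]
    have ha := W.fst_mem_support_of_mem_edges hab
    have hb := W.snd_mem_support_of_mem_edges hab
    exact ⟨⟨C, hC, hCs _ ha⟩, hA _ ha, ⟨C, hC, hCs _ hb⟩, hA _ hb, C, hC, hCe _ hab⟩

/-- Vertices of the connectivity graph at `{x, y}` lying in the same component of it. -/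
def LocallyConnected (G : SimpleGraph V) (r : ℕ) (x y u v : V) : Prop :=
  ∃ (hu : u ∈ G.setNeighborhood {x, y}) (hv : v ∈ G.setNeighborhood {x, y}),
    (G.connectivityGraph r x y).Reachable ⟨u, hu⟩ ⟨v, hv⟩

theorem LocallyConnected.symm {r : ℕ} {x y u v : V} (huv : G.LocallyConnected r x y u v) :
    G.LocallyConnected r x y v u :=
  let ⟨hu, hv, h⟩ := huv
  ⟨hv, hu, h.symm⟩

theorem LocallyConnected.trans {r : ℕ} {x y u v w : V} (huv : G.LocallyConnected r x y u v)
    (hvw : G.LocallyConnected r x y v w) : G.LocallyConnected r x y u w :=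
  let ⟨hu, _, h⟩ := huv
  let ⟨_, hw, h'⟩ := hvw
  ⟨hu, hw, h.trans h'⟩

/-- A short walk avoiding the ends of an edge `xy` joins vertices in one component of the
connectivity graph at `{x, y}`. -/
theorem locallyConnected_of_walk {r : ℕ} {x y u v : V} (hxy : G.Adj x y)
    (hu : ∃ w ∈ ({x, y} : Set V), G.Adj w u) (hv : ∃ z ∈ ({x, y} : Set V), G.Adj z v)
    (W : G.Walk u v) (hW : ∀ a ∈ W.support, a ∉ ({x, y} : Set V)) (hlen : W.length + 3 ≤ r) :
    G.LocallyConnected r x y u v := by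
  refine ⟨⟨hW _ W.start_mem_support, hu⟩, ⟨hW _ W.end_mem_support, hv⟩, ?_⟩
  by_cases huv : u = v
  · subst huv; exact Reachable.refl _
  obtain ⟨w, hw, hwu⟩ := hu
  obtain ⟨z, hz, hzv⟩ := hv
  -- The ball is centred at the separator vertex next to `v`; the edge `xy` is spent only when `u`
  -- attaches to the other one, so closing up costs at most three edges.
  have key : ((G.localBall r z).deleteVerts {x, y}).SameComponent u v := by
    refine sameComponent_localBall_deleteVerts ?_ hwu W hzv.symm hW hlen
    rcases hw with rfl | rfl <;> rcases hz with rfl | rfl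
    exacts [.inl rfl, .inr hxy.symm, .inr hxy, .inl rfl]
  apply Adj.reachable
  refine ⟨fun h => huv (congrArg Subtype.val h), ?_⟩
  rcases hz with rfl | rfl
  exacts [.inl key, .inr key]

/-- There is a walk of length at most `l` from `u` to `v` that avoids `A`. -/
def AvoidingWalk (G : SimpleGraph V) (A : Set V) (l : ℕ) (u v : V) : Prop :=
  ∃ W : G.Walk u v, W.length ≤ l ∧ ∀ a ∈ W.support, a ∉ A

theorem AvoidingWalk.refl {A : Set V} {u : V} (hu : u ∉ A) : G.AvoidingWalk A 0 u u :=
  ⟨.nil, le_rfl, by simpa using hu⟩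

theorem AvoidingWalk.of_adj {A : Set V} {u v : V} (hu : u ∉ A) (hv : v ∉ A) (h : G.Adj u v) :
    G.AvoidingWalk A 1 u v :=
  ⟨.cons h .nil, le_rfl, by simp [hu, hv]⟩

theorem AvoidingWalk.mono {A : Set V} {u v : V} {l m : ℕ} (h : G.AvoidingWalk A l u v)
    (hlm : l ≤ m) : G.AvoidingWalk A m u v :=
  let ⟨W, hl, hA⟩ := h
  ⟨W, hl.trans hlm, hA⟩

theorem AvoidingWalk.trans {A : Set V} {u v w : V} {l m : ℕ} (h : G.AvoidingWalk A l u v)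
    (h' : G.AvoidingWalk A m v w) : G.AvoidingWalk A (l + m) u w := by
  obtain ⟨W, hl, hA⟩ := h
  obtain ⟨W', hl', hA'⟩ := h'
  refine ⟨W.append W', by simp; omega, fun a ha => ?_⟩
  rcases Walk.mem_support_append_iff W W' |>.1 ha with ha | ha
  exacts [hA _ ha, hA' _ ha]

theorem AvoidingWalk.map {V' : Type*} {G' : SimpleGraph V'} {A : Set V} {A' : Set V'} {u v : V}
    {l : ℕ} (h : G.AvoidingWalk A l u v) (f : G →g G') (hf : ∀ a, f a ∈ A' → a ∈ A) :
    G'.AvoidingWalk A' l (f u) (f v) := by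
  obtain ⟨W, hl, hA⟩ := h
  refine ⟨W.map f, by simpa using hl, fun a ha => ?_⟩
  obtain ⟨b, hb, rfl⟩ : ∃ b ∈ W.support, f b = a := by simpa using ha
  exact fun h' => hA b hb (hf b h')

end SimpleGraph

/-! ### Walks in Cayley graphs that cross cosets of `⟨h⟩`. -/

section

open SimpleGraph

variable {Γ : Type*} [Group Γ] {S : Set Γ} {h : Γ}

theorem mulCayley_adj_mul_right (hS_one : (1 : Γ) ∉ S) (g : Γ) {s : Γ} (hs : s ∈ S) :
    (mulCayley S).Adj g (g * s) := by
  rw [mulCayley_adj']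
  exact ⟨fun h => hS_one (left_eq_mul.1 h ▸ hs), s, hs, .inl rfl⟩

theorem mem_zpowers_iff_of_mul_self (hh : h * h = 1) {x : Γ} :
    x ∈ Subgroup.zpowers h ↔ x = 1 ∨ x = h := by
  constructor
  · rintro ⟨k, rfl⟩
    rcases Int.even_or_odd' k with ⟨m, rfl | rfl⟩
    · left; simp [zpow_mul, pow_two, hh]
    · right; simp [zpow_add, zpow_mul, pow_two, hh]
  · rintro (rfl | rfl)
    exacts [one_mem _, Subgroup.mem_zpowers _]

/-- Left multiplication as an endomorphism of a Cayley graph. -/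
def mulCayleyMulLeft (S : Set Γ) (c : Γ) : mulCayley S →g mulCayley S where
  toFun := (c * ·)
  map_rel' h := mulCayley_adj_mul_iff_right.2 h

/-- The connectivity relation at the coset `c⟨h⟩`, transported to `⟨h⟩`. -/
theorem locallyConnected_of_avoidingWalk {r l : ℕ} (hS_one : (1 : Γ) ∉ S) (hh : h * h = 1)
    (hhS : h ∈ S) {c u v : Γ} (hu : ∃ w ∈ Subgroup.zpowers h, ∃ s ∈ S, c⁻¹ * u = w * s)
    (hv : ∃ w ∈ Subgroup.zpowers h, ∃ s ∈ S, c⁻¹ * v = w * s)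
    (hW : (mulCayley S).AvoidingWalk {z | c⁻¹ * z ∈ Subgroup.zpowers h} l u v) (hl : l + 3 ≤ r) :
    (mulCayley S).LocallyConnected r 1 h (c⁻¹ * u) (c⁻¹ * v) := by
  have key : ∀ x, (∃ w ∈ Subgroup.zpowers h, ∃ s ∈ S, x = w * s) →
      ∃ w ∈ ({1, h} : Set Γ), (mulCayley S).Adj w x := by
    rintro x ⟨w, hw, s, hs, rfl⟩
    exact ⟨w, (mem_zpowers_iff_of_mul_self hh).1 hw, mulCayley_adj_mul_right hS_one w hs⟩
  obtain ⟨W, hWl, hWA⟩ : (mulCayley S).AvoidingWalk {1, h} l (c⁻¹ * u) (c⁻¹ * v) :=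
    hW.map (mulCayleyMulLeft S c⁻¹) fun a ha => (mem_zpowers_iff_of_mul_self hh).2 ha
  exact locallyConnected_of_walk (by simpa using mulCayley_adj_mul_right hS_one 1 hhS)
    (key _ hu) (key _ hv) W hWA (by omega)

theorem avoidingWalk_of_inv_mul_mem (hS_one : (1 : Γ) ∉ S) (hh : h * h = 1) (hhS : h ∈ S)
    {A : Set Γ} {x y : Γ} (hx : x ∉ A) (hy : y ∉ A) (hxy : x⁻¹ * y ∈ Subgroup.zpowers h) :
    (mulCayley S).AvoidingWalk A 1 x y := by
  rcases (mem_zpowers_iff_of_mul_self hh).1 hxy with h0 | h0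
  · rw [← inv_mul_eq_one.1 h0]
    exact (AvoidingWalk.refl hx).mono zero_le_one
  · refine .of_adj hx hy ?_
    rw [inv_mul_eq_iff_eq_mul.1 h0]
    exact mulCayley_adj_mul_right hS_one _ hhS

/-- The vertices at which the walk with turns `e i ∈ {1, h}` and steps `a i` arrives. -/
def turnPath (e a : ℕ → Γ) : ℕ → Γ
  | 0 => 1
  | i + 1 => turnPath e a i * e i * a i

theorem turnPath_avoidingWalk {e a : ℕ → Γ} {L : ℕ} (hS_one : (1 : Γ) ∉ S) (hh : h * h = 1)
    (hhS : h ∈ S) (he : ∀ i, e i ∈ Subgroup.zpowers h) (ha : ∀ i < L, a i ∈ S) (c : Γ) {i d : ℕ}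
    (hd : i + d ≤ L)
    (hc : ∀ k, i ≤ k → k ≤ i + d → c⁻¹ * turnPath e a k ∉ Subgroup.zpowers h) :
    (mulCayley S).AvoidingWalk {z | c⁻¹ * z ∈ Subgroup.zpowers h} (2 * d)
      (turnPath e a i) (turnPath e a (i + d)) := by
  induction d with
  | zero => exact .refl (hc i le_rfl le_rfl)
  | succ d ih =>
    have h1 := ih (by omega) fun k h1 h2 => hc k h1 (by omega)
    have hp := hc (i + d) (by omega) (by omega)
    have hp' := hc (i + d + 1) (by omega) (by omega)
    have hq : c⁻¹ * (turnPath e a (i + d) * e (i + d)) ∉ Subgroup.zpowers h := by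
      rw [← mul_assoc, Subgroup.mul_mem_cancel_right _ (he _)]; exact hp
    have h2 : (mulCayley S).AvoidingWalk {z | c⁻¹ * z ∈ Subgroup.zpowers h} 1
        (turnPath e a (i + d)) (turnPath e a (i + d) * e (i + d)) :=
      avoidingWalk_of_inv_mul_mem hS_one hh hhS hp hq (by simpa using he (i + d))
    have h3 : (mulCayley S).AvoidingWalk {z | c⁻¹ * z ∈ Subgroup.zpowers h} 1
        (turnPath e a (i + d) * e (i + d)) (turnPath e a (i + d + 1)) :=
      .of_adj hq hp' (mulCayley_adj_mul_right hS_one _ (ha _ (by omega)))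
    exact ((h1.trans h2).trans h3).mono (by omega)

/-- A short walk crossing the local separators `p⟨h⟩` at all its turns in `T` never returns to
such a coset. -/
theorem turnPath_not_mem {e a : ℕ → Γ} {L r : ℕ} (T : ℕ → Prop) (hS_one : (1 : Γ) ∉ S)
    (hS_inv : ∀ s ∈ S, s⁻¹ ∈ S) (hh : h * h = 1) (hhS : h ∈ S)
    (he : ∀ i, e i ∈ Subgroup.zpowers h) (ha : ∀ i < L, a i ∈ S) (hL : 2 * L ≤ r)
    (hgood : ∀ i, i + 1 < L → T (i + 1) →
      ¬ (mulCayley S).LocallyConnected r 1 h (a i)⁻¹ (e (i + 1) * a (i + 1)))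
    (hbad : ∀ i j, i < j → j ≤ L → T i ∨ T j → (∀ k, i < k → k < j → ¬ T k) →
      (turnPath e a i)⁻¹ * turnPath e a j ∉ Subgroup.zpowers h)
    {i j : ℕ} (hij : i < j) (hj : j ≤ L) (hT : T i ∨ T j) :
    (turnPath e a i)⁻¹ * turnPath e a j ∉ Subgroup.zpowers h := by
  obtain ⟨d, hd⟩ : ∃ d, d = j - i := ⟨_, rfl⟩
  -- Given a crossing `k` strictly between `i` and `j`, the shorter stretches `i..k` and `k..j` do
  -- not return, so everything else on the stretch avoids the coset at `k`.
  induction d using Nat.strong_induction_on generalizing i j with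
  | _ d ih =>
    by_cases hk : ∃ k, i < k ∧ k < j ∧ T k
    swap
    · push Not at hk
      exact hbad i j hij hj hT hk
    obtain ⟨k, hik, hkj, hTk⟩ := hk
    intro hmem
    have hlt : ∀ m, k < m → m ≤ j → (turnPath e a k)⁻¹ * turnPath e a m ∉ Subgroup.zpowers h :=
      fun m h1 h2 => ih (m - k) (by omega) h1 (by omega) (.inl hTk) rfl
    have hgt : ∀ m, i ≤ m → m < k → (turnPath e a k)⁻¹ * turnPath e a m ∉ Subgroup.zpowers h := by
      intro m h1 h2 h3
      refine ih (k - m) (by omega) h2 (by omega) (.inr hTk) rfl ?_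
      simpa using inv_mem h3
    obtain ⟨k, rfl⟩ : ∃ k', k = k' + 1 := ⟨k - 1, by omega⟩
    set c := turnPath e a (k + 1) with hc
    have hmulq : ∀ m, i ≤ m → m < k + 1 →
        c⁻¹ * (turnPath e a m * e m) ∉ Subgroup.zpowers h := by
      intro m h1 h2
      rw [← mul_assoc, Subgroup.mul_mem_cancel_right _ (he _)]
      exact hgt m h1 h2
    have w1 : (mulCayley S).AvoidingWalk {z | c⁻¹ * z ∈ Subgroup.zpowers h} (2 * (j - (k + 2)))
        (turnPath e a (k + 2)) (turnPath e a j) := by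
      have := turnPath_avoidingWalk (i := k + 2) (d := j - (k + 2)) hS_one hh hhS he ha c (by omega)
        fun m h1 h2 => hlt m (by omega) (by omega)
      rwa [show k + 2 + (j - (k + 2)) = j by omega] at this
    -- The assumed return closes the stretch up by at most one edge, landing directly behind the
    -- turn at `i`. The detour `w1`, `w2`, `w3` then has length at most `2 * (j - i) - 3`, which
    -- leaves room for the three closing edges.
    have w2 : (mulCayley S).AvoidingWalk {z | c⁻¹ * z ∈ Subgroup.zpowers h} 1
        (turnPath e a j) (turnPath e a i * e i) := by
      have h1 : (turnPath e a j)⁻¹ * (turnPath e a i * e i) ∈ Subgroup.zpowers h := by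
        rw [← mul_assoc, Subgroup.mul_mem_cancel_right _ (he _)]
        simpa using inv_mem hmem
      exact avoidingWalk_of_inv_mul_mem hS_one hh hhS (hlt j (by omega) le_rfl)
        (hmulq i le_rfl (by omega)) h1
    have w3 : ∀ m, i ≤ m → m ≤ k → (mulCayley S).AvoidingWalk {z | c⁻¹ * z ∈ Subgroup.zpowers h}
        (2 * (m - i)) (turnPath e a i * e i) (turnPath e a m * e m) := by
      intro m him hmk
      induction m, him using Nat.le_induction with
      | base =>
        rw [Nat.sub_self]
        exact .refl (hmulq i le_rfl (by omega))
      | succ m him ihm =>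
        have hp := hgt (m + 1) (by omega) (by omega)
        have hq := hmulq (m + 1) (by omega) (by omega)
        have h1 : (mulCayley S).AvoidingWalk {z | c⁻¹ * z ∈ Subgroup.zpowers h} 1
            (turnPath e a m * e m) (turnPath e a (m + 1)) :=
          .of_adj (hmulq m him (by omega)) hp (mulCayley_adj_mul_right hS_one _ (ha _ (by omega)))
        have h2 : (mulCayley S).AvoidingWalk {z | c⁻¹ * z ∈ Subgroup.zpowers h} 1
            (turnPath e a (m + 1)) (turnPath e a (m + 1) * e (m + 1)) :=
          avoidingWalk_of_inv_mul_mem hS_one hh hhS hp hq (by simpa using he (m + 1))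
        exact (((ihm (by omega)).trans h1).trans h2).mono (by omega)
    have hu : c⁻¹ * turnPath e a (k + 2) = e (k + 1) * a (k + 1) := by
      simp [hc, turnPath, mul_assoc]
    have hv : c⁻¹ * (turnPath e a k * e k) = (a k)⁻¹ := by
      simp [hc, turnPath, mul_assoc]
    have key := locallyConnected_of_avoidingWalk (r := r) hS_one hh hhS (c := c)
      ⟨_, he _, _, ha (k + 1) (by omega), hu⟩
      ⟨1, one_mem _, _, hS_inv _ (ha k (by omega)), by rw [hv, one_mul]⟩
      ((w1.trans w2).trans (w3 k (by omega) le_rfl)) (by omega)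
    rw [hu, hv] at key
    exact hgood k (by omega) hTk key.symm

theorem turnPath_mul_of_periodic {e a : ℕ → Γ} {k : ℕ} (he : ∀ i, e (i + k) = e i)
    (ha : ∀ i, a (i + k) = a i) (m : ℕ) : turnPath e a (k * m) = turnPath e a k ^ m := by
  have hadd : ∀ i, turnPath e a (i + k) = turnPath e a k * turnPath e a i := by
    intro i
    induction i with
    | zero => simp [turnPath]
    | succ i ih =>
      rw [show i + 1 + k = i + k + 1 by omega]
      simp only [turnPath, ih, he, ha, mul_assoc]
  induction m with
  | zero => simp [turnPath]
  | succ m ih => rw [Nat.mul_succ, hadd, ih, pow_succ']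

/-- A short walk crossing the local separators `p⟨h⟩` at every other turn, without doubling back
at the remaining turns, is not closed. -/
theorem turnPath_ne_one_of_even {e a : ℕ → Γ} {L r : ℕ} (hS_one : (1 : Γ) ∉ S)
    (hS_inv : ∀ s ∈ S, s⁻¹ ∈ S) (hh : h * h = 1) (hhS : h ∈ S)
    (he : ∀ i, e i ∈ Subgroup.zpowers h) (ha : ∀ i, a i ∈ S) (ha' : ∀ i, a i ∉ Subgroup.zpowers h)
    (hL : 2 * L ≤ r) (hL0 : 0 < L) (hLe : Even L)
    (hgood : ∀ i, Odd i →
      ¬ (mulCayley S).LocallyConnected r 1 h (a i)⁻¹ (e (i + 1) * a (i + 1)))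
    (hbad : ∀ i, Even i → a i * e (i + 1) * a (i + 1) ∉ Subgroup.zpowers h) :
    turnPath e a L ≠ 1 := by
  intro h1
  refine turnPath_not_mem (i := 0) (j := L) (fun i => Even i) hS_one hS_inv hh hhS he
    (fun i _ => ha i) hL ?_ ?_ hL0 le_rfl (.inr hLe) (by simp [h1, turnPath, one_mem])
  · intro i _ hi
    exact hgood i (by grind)
  · intro i j hij _ hT hno
    have hji : j ≤ i + 2 := by
      by_contra! hlt
      have h1 := hno (i + 1) (by omega) (by omega)
      have h2 := hno (i + 2) (by omega) (by omega)
      grind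
    obtain rfl | rfl : j = i + 1 ∨ j = i + 2 := by omega
    · simpa [turnPath, mul_assoc, Subgroup.mul_mem_cancel_left _ (he i)] using ha' i
    · have hi : Even i := by grind
      simpa [turnPath, mul_assoc, Subgroup.mul_mem_cancel_left _ (he i)] using hbad i hi

/-! ### Commutators with the involution and the sides of a generator. -/

/-- Conjugation by `h` inverts `h * g⁻¹ * h * g`, so each further commutator with `h` merely
squares. -/
theorem iteratedCommutator_involution (hh : h * h = 1) (g : Γ) (m : ℕ) :
    iteratedCommutator h g (m + 1) = (h * g⁻¹ * h * g) ^ 2 ^ m := by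
  have hi : h⁻¹ = h := inv_eq_of_mul_eq_one_left hh
  induction m with
  | zero => simp [iteratedCommutator, hi]
  | succ m ih =>
    have h1 : h * (h * g⁻¹ * h * g)⁻¹ * h⁻¹ = h * g⁻¹ * h * g := by
      simp [mul_assoc, hi, hh]
    rw [iteratedCommutator, ih, ← inv_pow, ← conj_pow, h1, ← pow_add, pow_succ 2 m, mul_two]

theorem not_mem_zpowers_of_not_commute {g : Γ} (hg : ¬ Commute g h) :
    g ∉ Subgroup.zpowers h := by
  rintro ⟨k, rfl⟩
  exact hg ((Commute.refl h).zpow_left k)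

theorem inv_mul_mul_not_mem_zpowers (hh : h * h = 1) {g : Γ} (hg : ¬ Commute g h) :
    g⁻¹ * h * g ∉ Subgroup.zpowers h := by
  intro h1
  rcases (mem_zpowers_iff_of_mul_self hh).1 h1 with h2 | h2
  · have h3 : h = 1 := by simpa [mul_assoc, inv_mul_eq_iff_eq_mul] using h2
    exact hg (h3 ▸ Commute.one_right g)
  · rw [mul_assoc, inv_mul_eq_iff_eq_mul] at h2
    exact hg h2.symm

theorem mul_mul_inv_not_mem_zpowers (hh : h * h = 1) {g : Γ} (hg : ¬ Commute g h) :
    g * h * g⁻¹ ∉ Subgroup.zpowers h := by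
  simpa using inv_mul_mul_not_mem_zpowers hh (g := g⁻¹) (by simpa using hg)

section

variable {m r : ℕ} (hΓ : IteratedCommutatorNilpotent Γ (m + 1))
  (hS_one : (1 : Γ) ∉ S) (hS_inv : ∀ s ∈ S, s⁻¹ ∈ S)
  (hr : 2 ^ (m + 3) ≤ r) (hh : h * h = 1) (hhS : h ∈ S)

include hΓ hS_one hS_inv hr hh hhS

/-- Otherwise `(h g⁻¹ h g) ^ 2 ^ m`, which is trivial as an iterated commutator, would cross at
every turn from `g` to `g⁻¹`. -/
theorem locallyConnected_inv_mul_inv {g : Γ} (hgS : g ∈ S) (hg : ¬ Commute g h) :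
    (mulCayley S).LocallyConnected r 1 h g⁻¹ (h * g⁻¹) := by
  by_contra hLC
  have hgH := not_mem_zpowers_of_not_commute hg
  set a : ℕ → Γ := fun i => if Even i then g⁻¹ else g with ha
  refine turnPath_ne_one_of_even (e := fun _ => h) (a := a) (L := 2 * 2 ^ m) (r := r) hS_one hS_inv
    hh hhS (fun _ => Subgroup.mem_zpowers h) ?_ ?_ ?_ (by positivity) (by simp) ?_ ?_ ?_
  · intro i
    by_cases hi : Even i <;> simp [ha, hi, hgS, hS_inv]
  · intro i
    by_cases hi : Even i <;> simp [ha, hi, hgH]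
  · rw [pow_add] at hr; omega
  · intro i hi
    have h1 : ¬ Even i := by grind
    have h2 : Even (i + 1) := by grind
    simpa only [ha, if_neg h1, if_pos h2] using hLC
  · intro i hi
    have h2 : ¬ Even (i + 1) := by grind
    simpa only [ha, if_neg h2, if_pos hi] using inv_mul_mul_not_mem_zpowers hh hg
  · rw [turnPath_mul_of_periodic (fun _ => rfl) (fun i => by simp [ha, Nat.even_add])]
    have h1 : turnPath (fun _ => h) a 2 = h * g⁻¹ * h * g := by simp [turnPath, ha]
    rw [h1, ← iteratedCommutator_involution hh]
    refine hΓ _ _ ?_ ?_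
    · rintro rfl; exact hg (Commute.refl _)
    · rintro rfl; exact hg (Commute.refl _).inv_right

theorem locallyConnected_mul {g : Γ} (hgS : g ∈ S) (hg : ¬ Commute g h) :
    (mulCayley S).LocallyConnected r 1 h g (h * g) := by
  simpa using locallyConnected_inv_mul_inv hΓ hS_one hS_inv hr hh hhS (hS_inv g hgS)
    (by simpa using hg)

/-- Otherwise the turns inside `g g` and `g⁻¹ g⁻¹` would cross. These are every other turn of the
powers of `g⁻¹ h g g h g⁻¹`, a conjugate of the commutator of `h` and `g⁻²`. -/
theorem locallyConnected_inv {g : Γ} (hgS : g ∈ S) (hg : ¬ Commute g h) :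
    (mulCayley S).LocallyConnected r 1 h g g⁻¹ := by
  by_contra hLC
  have hgH := not_mem_zpowers_of_not_commute hg
  set e : ℕ → Γ := fun i => if Even i then 1 else h with he
  set a : ℕ → Γ := fun i => if i % 4 = 0 ∨ i % 4 = 3 then g⁻¹ else g with ha
  refine turnPath_ne_one_of_even (e := e) (a := a) (L := 4 * 2 ^ m) (r := r) hS_one hS_inv
    hh hhS ?_ ?_ ?_ ?_ (by positivity) ?_ ?_ ?_ ?_
  · intro i
    by_cases hi : Even i <;> simp [he, hi, one_mem]
  · intro i
    by_cases hi : i % 4 = 0 ∨ i % 4 = 3 <;> simp [ha, hi, hgS, hS_inv]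
  · intro i
    by_cases hi : i % 4 = 0 ∨ i % 4 = 3 <;> simp [ha, hi, hgH]
  · rw [pow_add] at hr; omega
  · exact (by decide : Even 4).mul_right _
  · intro i hi
    have h2 : Even (i + 1) := by grind
    rcases (by grind : i % 4 = 1 ∨ i % 4 = 3) with h1 | h1
    · have h3 : (i + 1) % 4 = 2 := by omega
      simpa [ha, he, h1, h2, h3] using fun h' => hLC (LocallyConnected.symm h')
    · have h3 : (i + 1) % 4 = 0 := by omega
      simpa [ha, he, h1, h2, h3] using hLC
  · intro i hi
    have h2 : ¬ Even (i + 1) := by grind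
    rcases (by grind : i % 4 = 0 ∨ i % 4 = 2) with h1 | h1
    · have h3 : (i + 1) % 4 = 1 := by omega
      simpa [ha, he, h1, h2, h3] using inv_mul_mul_not_mem_zpowers hh hg
    · have h3 : (i + 1) % 4 = 3 := by omega
      simpa [ha, he, h1, h2, h3] using mul_mul_inv_not_mem_zpowers hh hg
  · have h4 : Even 4 := by decide
    rw [turnPath_mul_of_periodic (fun i => by simp [he, Nat.even_add, h4])
      (fun i => by simp [ha])]
    have h1 : turnPath e a 4 = g⁻¹ * (h * (g * g)⁻¹⁻¹ * h * (g * g)⁻¹) * g⁻¹⁻¹ := by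
      simp [turnPath, ha, he, mul_assoc, show ¬ Even 3 by decide]
    rw [h1, conj_pow, ← iteratedCommutator_involution hh, hΓ, mul_one, mul_inv_cancel]
    · intro h2
      have h3 : h = (g * g)⁻¹ := h2
      apply hg
      rw [h3]
      exact ((Commute.refl g).mul_right (Commute.refl g)).inv_right
    · intro h2
      apply hg
      rw [h2, inv_inv]
      exact (Commute.refl g).mul_right (Commute.refl g)

/-- When `s` commutes with `h`, the vertices `s` and `h * s = s * h` are adjacent. -/
theorem locallyConnected_mul_of_mem {s : Γ} (hsS : s ∈ S) (hs : s ∉ Subgroup.zpowers h) :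
    (mulCayley S).LocallyConnected r 1 h s (h * s) := by
  by_cases hc : Commute s h
  swap
  · exact locallyConnected_mul hΓ hS_one hS_inv hr hh hhS hsS hc
  have h1 : (mulCayley S).AvoidingWalk {z | (1 : Γ)⁻¹ * z ∈ Subgroup.zpowers h} 1 s (h * s) := by
    refine .of_adj (by simpa using hs) ?_ ?_
    · simpa [Subgroup.mul_mem_cancel_left _ (Subgroup.mem_zpowers h)] using hs
    · rw [← hc.eq]; exact mulCayley_adj_mul_right hS_one s hhS
  have hr4 : 1 + 3 ≤ r := by
    have := Nat.one_le_two_pow (n := m)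
    rw [pow_add] at hr; omega
  simpa using locallyConnected_of_avoidingWalk (r := r) hS_one hh hhS
    ⟨1, one_mem _, s, hsS, by simp⟩ ⟨h, Subgroup.mem_zpowers h, s, hsS, by simp⟩ h1 hr4

/-- Neighbours of `h` share a side with neighbours of `1`, so generators represent all sides. -/
theorem exists_not_locallyConnected (g : Γ)
    (hsep : ¬ ((mulCayley S).connectivityGraph r 1 h).Preconnected) :
    ∃ s ∈ S, s ∉ Subgroup.zpowers h ∧ ¬ (mulCayley S).LocallyConnected r 1 h g s := by
  by_contra! hall
  have key : ∀ u ∈ (mulCayley S).setNeighborhood {1, h},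
      (mulCayley S).LocallyConnected r 1 h g u := by
    rintro u ⟨hu, x, hx, hxu⟩
    rw [mulCayley_adj'] at hxu
    obtain ⟨s, hs, rfl⟩ : ∃ s ∈ S, x * s = u := by
      obtain ⟨-, s, hs, h1 | h1⟩ := hxu
      · exact ⟨s, hs, h1⟩
      · exact ⟨s⁻¹, hS_inv s hs, by rw [h1]; simp⟩
    have hu' : x * s ∉ Subgroup.zpowers h := fun h1 =>
      hu ((mem_zpowers_iff_of_mul_self hh).1 h1)
    have hsH : s ∉ Subgroup.zpowers h := by
      rwa [Subgroup.mul_mem_cancel_left _ ((mem_zpowers_iff_of_mul_self hh).2 hx)] at hu'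
    rcases hx with rfl | rfl
    · rw [one_mul]; exact hall s hs hsH
    · exact (hall s hs hsH).trans
        (locallyConnected_mul_of_mem hΓ hS_one hS_inv hr hh hhS hs hsH)
  refine hsep fun u v => ?_
  obtain ⟨_, _, h1⟩ := (key u u.2).symm.trans (key v v.2)
  exact h1

end

/-! ### Alternating commutator words and centrality of `h`. -/

/-- One of `x`, `y` is `g` or its inverse, the other one is `s` or its inverse. -/
def AlternatingLetters (g s x y : Γ) : Prop :=
  ((x = g ∨ x = g⁻¹) ∧ (y = s ∨ y = s⁻¹)) ∨ ((x = s ∨ x = s⁻¹) ∧ (y = g ∨ y = g⁻¹))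

/-- The iterated commutator `[g, s]ₘ₊₁` is an alternating word of length `2 ^ (m + 2)`. -/
theorem exists_alternating_word (g s : Γ) (m : ℕ) :
    ∃ l : List Γ, l.length + 1 = 2 ^ (m + 2) ∧ (g :: l).prod = iteratedCommutator g s (m + 1) ∧
      (g :: (l ++ [g⁻¹])).IsChain (AlternatingLetters g s) := by
  induction m with
  | zero =>
    exact ⟨[s⁻¹, g⁻¹, s], by simp, by simp [iteratedCommutator, mul_assoc], by
      simp [AlternatingLetters]⟩
  | succ m ih =>
    obtain ⟨l, hlen, hprod, hchain⟩ := ih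
    -- With `w = g l`, the product `g w⁻¹ g⁻¹ w` reduces to `g l⁻¹ g⁻¹ l`. The final `g⁻¹` in the
    -- chain records that the word ends in `s` or `s⁻¹`; it makes the pattern stable under inversion
    -- and lets the halves be spliced.
    refine ⟨(l.map (·⁻¹)).reverse ++ g⁻¹ :: l, ?_, ?_, ?_⟩
    · rw [pow_succ, ← hlen]; simp; omega
    · rw [iteratedCommutator, ← hprod]
      simp [← List.prod_inv_reverse, mul_assoc]
    · have h1 : (g :: ((l.map (·⁻¹)).reverse ++ [g⁻¹])).IsChain (AlternatingLetters g s) := by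
        have h2 : g :: ((l.map (·⁻¹)).reverse ++ [g⁻¹]) =
            ((g :: (l ++ [g⁻¹])).map (·⁻¹)).reverse := by simp
        rw [h2, List.isChain_reverse, List.isChain_map]
        refine hchain.imp fun x y hxy => ?_
        simp only [AlternatingLetters, inv_eq_iff_eq_inv, inv_inv] at hxy ⊢
        tauto
      have h3 : (g⁻¹ :: (l ++ [g⁻¹])).IsChain (AlternatingLetters g s) := by
        rw [List.isChain_cons] at hchain ⊢
        refine ⟨fun y hy => ?_, hchain.2⟩
        have := hchain.1 y hy
        rcases this with ⟨-, h4⟩ | ⟨h4, h4'⟩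
        · exact .inl ⟨.inr rfl, h4⟩
        · refine .inr ⟨?_, h4'⟩
          rcases h4 with h4 | h4
          exacts [.inr (by rw [h4]), .inl (by rw [h4, inv_inv])]
      have h5 := (List.isChain_split (l₁ := g :: (l.map (·⁻¹)).reverse) (c := g⁻¹)
        (l₂ := l ++ [g⁻¹])).2 ⟨by simpa using h1, h3⟩
      simpa using h5

theorem turnPath_one_left {a : ℕ → Γ} (l : List Γ) (ha : ∀ (i : ℕ) (hi : i < l.length), a i = l[i])
    {i : ℕ} (hi : i ≤ l.length) : turnPath (fun _ => 1) a i = (l.take i).prod := by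
  induction i with
  | zero => simp [turnPath]
  | succ i ih =>
    rw [turnPath, ih (by omega), mul_one, ha i (by omega), List.prod_take_succ]

/-- A generator of an `r`-local separator `{1, h}` that is an involution commutes with every
generator. -/
theorem commute_of_isLocalTwoSeparator {m r : ℕ}
    (hΓ : IteratedCommutatorNilpotent Γ (m + 1))
    (hS_one : (1 : Γ) ∉ S) (hS_inv : ∀ s ∈ S, s⁻¹ ∈ S)
    (hr : 2 ^ (m + 3) ≤ r) (hh : h * h = 1) (hhS : h ∈ S)
    (hsep : ¬ ((mulCayley S).connectivityGraph r 1 h).Preconnected) {g : Γ} (hgS : g ∈ S) :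
    Commute g h := by
  by_contra hg
  obtain ⟨s, hsS, hsH, hLC⟩ :=
    exists_not_locallyConnected hΓ hS_one hS_inv hr hh hhS g hsep
  have hgi := locallyConnected_inv hΓ hS_one hS_inv hr hh hhS hgS hg
  have hgH := not_mem_zpowers_of_not_commute hg
  have hLC' : ¬ (mulCayley S).LocallyConnected r 1 h g⁻¹ s := fun h1 => hLC (hgi.trans h1)
  have hgs : g ≠ s := by
    rintro rfl
    exact hLC (hgi.trans hgi.symm)
  have hgs' : g ≠ s⁻¹ := by
    intro h1
    exact hLC (by simpa [h1] using hgi)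
  have hsC : (mulCayley S).LocallyConnected r 1 h g s⁻¹ → Commute s h := by
    intro h1
    by_contra hs
    exact hLC (h1.trans (locallyConnected_inv hΓ hS_one hS_inv hr hh hhS hsS hs).symm)
  obtain ⟨l, hlen, hprod, hchain⟩ := exists_alternating_word g s m
  rw [← List.cons_append, List.isChain_append] at hchain
  have hchain := List.isChain_iff_getElem.1 hchain.1
  obtain ⟨L, hL⟩ : ∃ L, L = (g :: l).length := ⟨_, rfl⟩
  have hL2 : L = 2 ^ (m + 2) := by rw [hL, ← hlen]; simp
  have hL4 : 4 ≤ L := by rw [hL2, pow_add]; have := Nat.one_le_two_pow (n := m); omega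
  set a : ℕ → Γ := fun i => (g :: l).getD i 1 with ha
  have haget : ∀ (i : ℕ) (hi : i < (g :: l).length), a i = (g :: l)[i] := fun i hi => by
    simp only [ha, List.getD_eq_getElem _ _ hi]
  have hR : ∀ i, i + 1 < L → AlternatingLetters g s (a i) (a (i + 1)) := by
    intro i hi
    rw [haget i (by omega), haget (i + 1) (by omega)]
    exact hchain i (by omega)
  have hmem : ∀ i < L, (a i = g ∨ a i = g⁻¹) ∨ (a i = s ∨ a i = s⁻¹) := by
    intro i hi
    by_cases hi' : i + 1 < L
    · rcases hR i hi' with h1 | h1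
      exacts [.inl h1.1, .inr h1.1]
    · obtain ⟨k, rfl⟩ : ∃ k, i = k + 1 := ⟨i - 1, by omega⟩
      rcases hR k hi with h1 | h1
      exacts [.inr h1.2, .inl h1.2]
  -- A turn fails to cross only if `s⁻¹` is on the side of `g`, which forces `s` to commute with
  -- `h`.
  have hturn : ∀ k, k + 1 < L → (mulCayley S).LocallyConnected r 1 h (a k)⁻¹ (a (k + 1)) →
      Commute s h ∧ (((a k = g ∨ a k = g⁻¹) ∧ a (k + 1) = s⁻¹) ∨
        (a k = s ∧ (a (k + 1) = g ∨ a (k + 1) = g⁻¹))) := by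
    intro k hk h1
    rcases hR k hk with ⟨h2 | h2, h3 | h3⟩ | ⟨h2 | h2, h3 | h3⟩ <;> rw [h2, h3] at h1
    · exact absurd h1 hLC'
    · exact ⟨hsC (hgi.trans h1), .inl ⟨.inl h2, h3⟩⟩
    · rw [inv_inv] at h1; exact absurd h1 hLC
    · rw [inv_inv] at h1; exact ⟨hsC h1, .inl ⟨.inr h2, h3⟩⟩
    · exact ⟨hsC h1.symm, .inr ⟨h2, .inl h3⟩⟩
    · exact ⟨hsC (hgi.trans h1.symm), .inr ⟨h2, .inr h3⟩⟩
    · rw [inv_inv] at h1; exact absurd h1.symm hLC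
    · rw [inv_inv] at h1; exact absurd h1.symm hLC'
  have hturn₂ : ∀ k, k + 2 < L → (mulCayley S).LocallyConnected r 1 h (a k)⁻¹ (a (k + 1)) →
      (mulCayley S).LocallyConnected r 1 h (a (k + 1))⁻¹ (a (k + 2)) →
      a k = s ∧ (a (k + 1) = g ∨ a (k + 1) = g⁻¹) ∧ a (k + 2) = s⁻¹ := by
    intro k hk h1 h2
    obtain ⟨-, ⟨-, h3⟩ | ⟨h3, h3'⟩⟩ := hturn k (by omega) h1 <;>
      obtain ⟨-, ⟨h4, h4'⟩ | ⟨h4, h4'⟩⟩ := hturn (k + 1) hk h2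
    · rcases h4 with h4 | h4 <;> rw [h3] at h4
      · exact absurd h4.symm hgs'
      · exact absurd (inv_injective h4).symm hgs
    · rw [h3] at h4 h1
      rcases hR k (by omega) with ⟨h5 | h5, -⟩ | ⟨-, h5 | h5⟩
      · rw [h4, h5] at h1; exact absurd h1 hLC'
      · rw [h4, h5, inv_inv] at h1; exact absurd h1 hLC
      · exact absurd (h5.symm.trans h3) hgs'
      · exact absurd (inv_injective (h5.symm.trans h3)) hgs
    · exact ⟨h3, h3', h4'⟩
    · rw [h4] at h3'
      rcases h3' with h5 | h5
      · exact absurd h5.symm hgs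
      · exact absurd (by rw [h5, inv_inv]) hgs'
  have hcomm : ∀ x ∈ Subgroup.zpowers h, Commute x h := by
    rintro _ ⟨k, rfl⟩
    exact (Commute.refl h).zpow_left k
  -- The start counts as a crossing by decree, so the truncated `k - 1` at `0` is harmless.
  refine turnPath_not_mem (i := 0) (j := L) (e := fun _ => 1) (a := a) (r := r)
    (fun k => k = 0 ∨ ¬ (mulCayley S).LocallyConnected r 1 h (a (k - 1))⁻¹ (a k)) hS_one hS_inv hh
    hhS (fun _ => one_mem _) ?_ ?_ ?_ ?_ (by omega) le_rfl (.inl (.inl rfl)) ?_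
  · intro i hi
    rcases hmem i hi with (h1 | h1) | h1 | h1 <;> rw [h1]
    exacts [hgS, hS_inv _ hgS, hsS, hS_inv _ hsS]
  · rw [hL2]; rw [pow_succ] at hr; omega
  · intro i _ hi
    simpa using hi
  · intro i j hij hj _ hno
    have hno' : ∀ k, i < k + 1 → k + 1 < j →
        (mulCayley S).LocallyConnected r 1 h (a k)⁻¹ (a (k + 1)) := by
      intro k h1 h2
      have := hno (k + 1) h1 h2
      simpa using this
    -- Two consecutive non-crossing turns spell `s g^{±1} s⁻¹`, and three cannot occur. So only
    -- stretches of at most three letters remain; if such a stretch lay in `⟨h⟩`, either a single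
    -- letter would, or `g` would commute with `h`.
    have hj3 : j ≤ i + 3 := by
      by_contra! hlt
      obtain ⟨-, h2, h3⟩ := hturn₂ i (by omega) (hno' i (by omega) (by omega))
        (hno' (i + 1) (by omega) (by omega))
      obtain ⟨h4, -, -⟩ := hturn₂ (i + 1) (by omega) (hno' (i + 1) (by omega) (by omega))
        (hno' (i + 2) (by omega) (by omega))
      rw [h4] at h2
      rcases h2 with h5 | h5
      · exact hgs h5.symm
      · exact hgs' (by rw [h5, inv_inv])
    obtain rfl | rfl | rfl : j = i + 1 ∨ j = i + 2 ∨ j = i + 3 := by omega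
    · have : a i ∉ Subgroup.zpowers h := by
        rcases hmem i (by omega) with (h1 | h1) | h1 | h1 <;> rw [h1] <;> simpa
      simpa [turnPath, mul_assoc] using this
    · obtain ⟨hc, hform⟩ := hturn i (by omega) (hno' i (by omega) (by omega))
      intro h1
      have h2 : Commute (a i * a (i + 1)) h := hcomm _ (by simpa [turnPath, mul_assoc] using h1)
      rcases hform with ⟨h3, h4⟩ | ⟨h4, h3⟩
      · have h5 : Commute (a i) h := by
          have := h2.mul_left (h4 ▸ hc.inv_left.inv_left : Commute (a (i + 1))⁻¹ h)
          simpa using this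
        rcases h3 with h3 | h3 <;> rw [h3] at h5 <;> exact hg (by simpa using h5)
      · have h5 : Commute (a (i + 1)) h := by
          have := (h4 ▸ hc.inv_left : Commute (a i)⁻¹ h).mul_left h2
          simpa using this
        rcases h3 with h3 | h3 <;> rw [h3] at h5 <;> exact hg (by simpa using h5)
    · obtain ⟨hc, -⟩ := hturn i (by omega) (hno' i (by omega) (by omega))
      obtain ⟨h2, h3, h4⟩ := hturn₂ i (by omega) (hno' i (by omega) (by omega))
        (hno' (i + 1) (by omega) (by omega))
      intro h1
      have h5 : Commute (s * a (i + 1) * s⁻¹) h :=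
        hcomm _ (by simpa [turnPath, mul_assoc, h2, h4] using h1)
      have h6 : Commute (a (i + 1)) h := by
        simpa [mul_assoc] using (hc.inv_left.mul_left h5).mul_left hc
      rcases h3 with h3 | h3 <;> rw [h3] at h6 <;> exact hg (by simpa using h6)
  · have h1 : turnPath (fun _ => 1) a L = 1 := by
      rw [turnPath_one_left (g :: l) haget hL.le, hL, List.take_length, hprod]
      exact hΓ g s hgs hgs'
    simp [h1, turnPath, one_mem]

end

theorem mainTheorem5 {Γ : Type*} [Group Γ] (n r : ℕ) (S : Set Γ) (h : Γ)
    (hΓ : IteratedCommutatorNilpotent Γ n)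
    (hS_one : (1 : Γ) ∉ S) (hS_inv : ∀ s ∈ S, s⁻¹ ∈ S) (hS_gen : Subgroup.closure S = ⊤)
    (hr : max (2 ^ (n + 2)) 10 ≤ r)
    (hhS : h ∈ S)
    (hsep : (SimpleGraph.mulCayley S).IsLocalTwoSeparator r 1 h)
    (hcut : ∀ v : Γ, ¬ (SimpleGraph.mulCayley S).IsLocalCutvertex r v)
    (hinv : orderOf h = 2) :
    (Subgroup.zpowers h).Normal := by
  have hh : h * h = 1 := by rw [← pow_two, ← hinv, pow_orderOf_eq_one]
  have h1 : h ≠ 1 := fun h0 => hS_one (h0 ▸ hhS)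
  obtain _ | m := n
  -- For `n = 0` the commutator `[1, h]₀` is `h` itself.
  · exact absurd (hΓ 1 h h1.symm (by simpa using h1)) h1
  have hle : Subgroup.closure S ≤ Subgroup.centralizer {h} := by
    rw [Subgroup.closure_le]
    intro g hg
    rw [SetLike.mem_coe, Subgroup.mem_centralizer_singleton_iff]
    exact commute_of_isLocalTwoSeparator hΓ hS_one hS_inv ((le_max_left _ _).trans hr) hh hhS
      hsep.2.2 hg
  have hcomm : ∀ g : Γ, Commute g h := fun g =>
    Subgroup.mem_centralizer_singleton_iff.1 (hle (hS_gen ▸ Subgroup.mem_top g))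
  refine ⟨fun x hx g => ?_⟩
  obtain ⟨k, rfl⟩ := hx
  have h2 : g * h ^ k * g⁻¹ = h ^ k := by rw [((hcomm g).zpow_right k).eq, mul_inv_cancel_right]
  exact h2 ▸ ⟨k, rfl⟩
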